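/- Throughout, linear orderings $X$ have as domain a set of natural numbers (possibly after identifying the elements of $X$ with natural numbers via an injective numbering), and $Z\in\mathbb N^{\mathbb N}$ is a real. The ordering $X$ is $Z$-computable if both its domain and the set $\{\langle x,y\rangle : x\le_X y\}$ are computable relative to $Z$. A descending sequence in a linear ordering is an infinite strictly decreasing sequence $a_0>a_1>a_2>\cdots$ of its elements; it is $Z$-computable (or computed by $Z$) if $n\mapsto a_n$ is computable relative to $Z$. For a linear ordering $X$, consider the formal terms built from the constants $0$ and $\varepsilon_x$ ($x\in X$) by means of $s+t$ and $\omega^t$. Sums are written without parentheses (associated to the right). Define normal forms and the relation $\le$ between normal forms simultaneously. A term $t=t_0+\dots+t_k$ is in normal form if either $t=0$, or $t_0\ge t_1\ge\dots\ge t_k$ and each $t_i$ is either a constant $\varepsilon_x$ or of the form $\omega^{s}$ with $s$ in normal form and $s$ not equal to any $\varepsilon_x$. For $t=t_0+\dots+t_k$ and $s=s_0+\dots+s_l$ in normal form, $t\le s$ if one of the following holds: (1) $t=0$; (2) $t=\varepsilon_x$ and $\varepsilon_y$ occurs in $s$ for some $y\ge_X x$; (3) $t=\omega^{t'}$, $s_0=\varepsilon_y$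 and $t'\le\varepsilon_y$; (4) $t=\omega^{t'}$, $s_0=\omega^{s'}$ and $t'\le s'$; (5) $k>0$, $t_0\le s_0$ and $t_0\neq s_0$; (6) $k>0$, $t_0=s_0$, $l>0$ and $t_1+\dots+t_k\le s_1+\dots+s_l$. Then $\boldsymbol\varepsilon_X$ denotes the set of terms in normal form, linearly ordered by $\le$; its elements are identified with natural numbers by a standard Gödel numbering of terms. Let $Z'=\{e:\{e\}^Z(e)\downarrow\}$ be the Turing jump, $Z^{(0)}=Z$, $Z^{(n+1)}=(Z^{(n)})'$, and let $Z^{(\omega)}=\bigoplus_{n\in\mathbb N}Z^{(n)}$ be the $\omega$-jump of $Z$, i.e. $Z^{(\omega)}(\langle n,y\rangle)=Z^{(n)}(y)$, where sets are identified with their characteristic functions. **Theorem.** Let $Z$ be a real. If $X$ is a $Z$-computable linear ordering and $\boldsymbol\varepsilon_X$ has a $Z$-computable descending sequence, then $Z^{(\omega)}$ computes a descending sequence in $X$. -/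

import Mathlib

/-! ### Oracle computability, the Turing jump and the `ω`-jump -/

/-- `f : ℕ → ℕ` is computable from the real `Z : ℕ → ℕ` (Turing reducibility `f ≤_T Z`). -/
def ComputableFrom (Z f : ℕ → ℕ) : Prop :=
  TuringReducible (f : ℕ →. ℕ) (Z : ℕ →. ℕ)

open Classical in
/-- The characteristic function of a set of natural numbers. -/
noncomputable def charFun (A : Set ℕ) : ℕ → ℕ := fun n => if n ∈ A then 1 else 0

/-- Programs for partial functions that are recursive in one (total) oracle. -/
inductive OracleCode : Type
  | zero : OracleCode
  | succ : OracleCode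
  | left : OracleCode
  | right : OracleCode
  | oracle : OracleCode
  | pair : OracleCode → OracleCode → OracleCode
  | comp : OracleCode → OracleCode → OracleCode
  | prec : OracleCode → OracleCode → OracleCode
  | rfind : OracleCode → OracleCode

namespace OracleCode

/-- The partial function computed by a program with oracle `Z`; the clauses are those of
`Nat.RecursiveIn`. -/
def eval (Z : ℕ → ℕ) : OracleCode → ℕ →. ℕ
  | zero => fun _ => Part.some 0
  | succ => fun n => Part.some (n + 1)
  | left => fun n => Part.some n.unpair.1
  | right => fun n => Part.some n.unpair.2
  | oracle => fun n => Part.some (Z n)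
  | pair cf cg => fun n => Nat.pair <$> eval Z cf n <*> eval Z cg n
  | comp cf cg => fun n => eval Z cg n >>= eval Z cf
  | prec cf cg => fun p =>
      p.unpair.2.rec (eval Z cf p.unpair.1) fun y IH => do
        let i ← IH
        eval Z cg (Nat.pair p.unpair.1 (Nat.pair y i))
  | rfind cf => fun a =>
      Nat.rfind fun n => (fun m => m = 0) <$> eval Z cf (Nat.pair a n)

/-- The Gödel number of a program (a bijection between programs and natural numbers). -/
def code : OracleCode → ℕ
  | zero => 0
  | succ => 1
  | left => 2
  | right => 3
  | oracle => 4
  | pair cf cg => 4 * Nat.pair (code cf) (code cg) + 5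
  | comp cf cg => 4 * Nat.pair (code cf) (code cg) + 6
  | prec cf cg => 4 * Nat.pair (code cf) (code cg) + 7
  | rfind cf => 4 * code cf + 8

theorem code_injective : Function.Injective code := by
  intro c
  induction c with
  | zero | succ | left | right | oracle =>
    intro d h; cases d <;> simp only [code] at h <;> first | rfl | omega
  | pair a b iha ihb | comp a b iha ihb | prec a b iha ihb =>
    intro d h
    cases d <;> simp only [code] at h <;> try omega
    rename_i a' b'
    have h' := Nat.pair_eq_pair.1 (show Nat.pair a.code b.code = Nat.pair a'.code b'.code by omega)
    rw [iha h'.1, ihb h'.2]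
  | rfind a iha =>
    intro d h
    cases d <;> simp only [code] at h <;> try omega
    rename_i a'
    rw [iha (show a.code = a'.code by omega)]

end OracleCode

/-- The Turing jump `Z' = {e : {e}^Z(e)↓}`, as a characteristic function. -/
noncomputable def turingJump (Z : ℕ → ℕ) : ℕ → ℕ :=
  charFun {e | ∃ c : OracleCode, c.code = e ∧ (c.eval Z e).Dom}

/-- The `ω`-jump `Z^(ω) = ⨁ₙ Z^(n)`, whose `n`-th column is the `n`-th iterate `Z^(n)` of the
Turing jump. -/
noncomputable def omegaJump (Z : ℕ → ℕ) : ℕ → ℕ :=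
  fun p => (turingJump^[p.unpair.1] Z) p.unpair.2

/-! ### Computable linear orderings

A countable linear ordering is presented by an injective numbering `ν` of its elements by natural
numbers: it is then identified with the ordering induced on the set `range ν ⊆ ℕ`. -/

/-- The linear ordering on `range ν ⊆ ℕ` is `Z`-computable: its domain and its order relation are
`Z`-computable. -/
def IsComputableLinearOrder {α : Type*} [LinearOrder α] (Z : ℕ → ℕ) (ν : α ↪ ℕ) : Prop :=
  ComputableFrom Z (charFun (Set.range ν)) ∧
    ComputableFrom Z (charFun {p | ∃ x y : α, x ≤ y ∧ p = Nat.pair (ν x) (ν y)})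

/-- `Z` computes a (strictly) descending infinite sequence in the ordering numbered by `ν`. -/
def ComputesDescendingSequence {α : Type*} [LinearOrder α] (Z : ℕ → ℕ) (ν : α ↪ ℕ) : Prop :=
  ∃ a : ℕ → α, StrictAnti a ∧ ComputableFrom Z (fun n => ν (a n))

/-! ### The operator `X ↦ ε_X` on linear orderings -/

/-- Formal terms built from the constants `0` and `ε_x` by `+` and `t ↦ ω^t`. -/
inductive EpsTerm (α : Type*) : Type _
  | zero : EpsTerm α
  | eps : α → EpsTerm α
  | add : EpsTerm α → EpsTerm α → EpsTerm α
  | omega : EpsTerm α → EpsTerm α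

namespace EpsTerm

variable {α : Type*}

/-- The first summand `t₀` of `t = t₀ + (t₁ + (⋯ + t_k))`. -/
def head : EpsTerm α → EpsTerm α
  | add t₀ _ => t₀
  | t => t

/-- The constant `ε_y` occurs in the term. -/
def Occurs (y : α) : EpsTerm α → Prop
  | zero => False
  | eps x => y = x
  | add s t => Occurs y s ∨ Occurs y t
  | omega t => Occurs y t

/-- The order relation `t ≤ s` (meaningful for terms in normal form). -/
def Le [LinearOrder α] : EpsTerm α → EpsTerm α → Prop
  | zero, _ => True
  | eps x, s => ∃ y, x ≤ y ∧ Occurs y s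
  | omega t', s =>
      match head s with
      | eps y => Le t' (eps y)
      | omega s' => Le t' s'
      | _ => False
  | add t₀ t₁, s =>
      (Le t₀ (head s) ∧ t₀ ≠ head s) ∨
        match s with
        | add s₀ s₁ => t₀ = s₀ ∧ Le t₁ s₁
        | _ => False

/-- The term is of the form `ε_x` or `ω^s`. -/
def IsPrincipal : EpsTerm α → Prop
  | eps _ => True
  | omega _ => True
  | _ => False

/-- Normal forms: `0`, or `t₀ + (t₁ + (⋯ + t_k))` with `t₀ ≥ t₁ ≥ ⋯ ≥ t_k`, where each `tᵢ` is some
`ε_x` or some `ω^s` with `s` in normal form and not of the form `ε_x`. -/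
def IsNF [LinearOrder α] : EpsTerm α → Prop
  | zero => True
  | eps _ => True
  | omega s => IsNF s ∧ ∀ x, s ≠ eps x
  | add t₀ t => IsPrincipal t₀ ∧ IsNF t₀ ∧ IsNF t ∧ t ≠ zero ∧ Le (head t) t₀

/-- The Gödel number of a term over an ordering numbered by `ν`. -/
def code (ν : α → ℕ) : EpsTerm α → ℕ
  | zero => 0
  | eps x => 3 * ν x + 1
  | add s t => 3 * Nat.pair (code ν s) (code ν t) + 2
  | omega t => 3 * code ν t + 3

theorem code_injective {ν : α → ℕ} (hν : Function.Injective ν) :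
    Function.Injective (code ν) := by
  intro c
  induction c with
  | zero => intro d h; cases d <;> simp only [code] at h <;> first | rfl | omega
  | eps x =>
    intro d h
    cases d <;> simp only [code] at h <;> try omega
    rename_i y
    rw [hν (show ν x = ν y by omega)]
  | add a b iha ihb =>
    intro d h
    cases d <;> simp only [code] at h <;> try omega
    rename_i a' b'
    have h' := Nat.pair_eq_pair.1
      (show Nat.pair (a.code ν) (b.code ν) = Nat.pair (a'.code ν) (b'.code ν) by omega)
    rw [iha h'.1, ihb h'.2]
  | omega a iha =>
    intro d h
    cases d <;> simp only [code] at h <;> try omega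
    rename_i a'
    rw [iha (show a.code ν = a'.code ν by omega)]

/-- The remaining summands `t₁ + (⋯ + t_k)` of `t = t₀ + (t₁ + (⋯ + t_k))`. -/
def tail : EpsTerm α → EpsTerm α
  | add _ t => t
  | _ => zero

/-- The exponent of a principal term, where `ε_x = ω^{ε_x}`. -/
def exponent : EpsTerm α → EpsTerm α
  | omega s => s
  | t => t

theorem Occurs.of_head {y : α} {t : EpsTerm α} (h : Occurs y t.head) : Occurs y t := by
  cases t <;> simp_all [EpsTerm.head, Occurs]

/-- The length of a term, for inductions. -/
def size : EpsTerm α → ℕ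
  | zero => 0
  | eps _ => 1
  | add s t => size s + size t + 1
  | omega t => size t + 1

theorem size_head_le (t : EpsTerm α) : t.head.size ≤ t.size := by
  cases t <;> simp [head, size]; omega

theorem size_exponent_le (t : EpsTerm α) : t.exponent.size ≤ t.size := by
  cases t <;> simp [exponent, size]

theorem size_tail_lt {t : EpsTerm α} (ht : t ≠ zero) : t.tail.size < t.size := by
  cases t <;> simp_all [tail, size]

/-! The relation `Le` is a linear order on the normal forms. -/

section Order

variable [LinearOrder α]

theorem IsNF.head {t : EpsTerm α} (ht : t.IsNF) : t.head.IsNF := by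
  cases t <;> simp_all [EpsTerm.head, IsNF]

theorem IsNF.tail {t : EpsTerm α} (ht : t.IsNF) : t.tail.IsNF := by
  cases t <;> simp_all [EpsTerm.tail, IsNF]

theorem IsNF.exponent {t : EpsTerm α} (ht : t.IsNF) : t.exponent.IsNF := by
  cases t <;> simp_all [EpsTerm.exponent, IsNF]

theorem le_refl (t : EpsTerm α) (ht : t.IsNF) : Le t t := by
  induction t with
  | zero => trivial
  | eps x => exact ⟨x, le_rfl, rfl⟩
  | omega t ih => exact ih ht.1
  | add p t _ iht => exact Or.inr ⟨rfl, iht ht.2.2.1⟩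

theorem occurs_aux (t : EpsTerm α) : t.IsNF →
    (∀ y, Occurs y t → ∃ z, y ≤ z ∧ Occurs z t.head) ∧
      (∀ s, Le t s → ∀ y, Occurs y t → ∃ z, y ≤ z ∧ Occurs z s) ∧
        ∀ s, Le t.head s → ∀ y, Occurs y t.head → ∃ z, y ≤ z ∧ Occurs z s := by
  induction t with
  | zero => intro _; simp [Occurs, head]
  | eps x => intro _; simp only [Occurs, Le, head]; aesop
  | omega t ih =>
    intro ht
    have key : ∀ s, Le (omega t) s → ∀ y, Occurs y t → ∃ z, y ≤ z ∧ Occurs z s := by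
      intro s hs y hy
      have := (ih ht.1).2.1
      rw [Le] at hs
      split at hs
      · rename_i z hz
        obtain ⟨w, hw, hw'⟩ := this _ hs y hy
        exact ⟨w, hw, .of_head (by rw [hz]; exact hw')⟩
      · rename_i z hz
        obtain ⟨w, hw, hw'⟩ := this _ hs y hy
        exact ⟨w, hw, .of_head (by rw [hz]; exact hw')⟩
      · exact hs.elim
    exact ⟨fun y hy => ⟨y, le_rfl, hy⟩, key, key⟩
  | add p t ihp iht =>
    rintro ⟨hp, hpn, htn, h0, hle⟩
    have key : ∀ y, Occurs y (add p t) → ∃ z, y ≤ z ∧ Occurs z p := by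
      rintro y (hy | hy)
      · exact ⟨y, le_rfl, hy⟩
      · obtain ⟨z, hz, hz'⟩ := (iht htn).1 y hy
        obtain ⟨w, hw, hw'⟩ := (iht htn).2.2 p hle z hz'
        exact ⟨w, hz.trans hw, hw'⟩
    refine ⟨key, fun s hs y hy => ?_, (ihp hpn).2.1⟩
    rcases hs with ⟨hs, -⟩ | hs
    · obtain ⟨z, hz, hz'⟩ := key y hy
      obtain ⟨w, hw, hw'⟩ := (ihp hpn).2.1 _ hs z hz'
      exact ⟨w, hz.trans hw, hw'.of_head⟩
    · cases s with
      | add s₀ s₁ =>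
        obtain ⟨rfl, hs⟩ := hs
        rcases hy with hy | hy
        · exact ⟨y, le_rfl, Or.inl hy⟩
        · obtain ⟨w, hw, hw'⟩ := (iht htn).2.1 _ hs y hy
          exact ⟨w, hw, Or.inr hw'⟩
      | _ => exact hs.elim

theorem not_le_zero {t : EpsTerm α} (ht : t.IsNF) (h : Le t zero) : t = zero := by
  cases t with
  | zero => rfl
  | eps x => simp [Le, Occurs] at h
  | omega t => simp [Le, head] at h
  | add p t =>
    have hp := ht.1
    cases p <;> simp_all [Le, head, Occurs, IsPrincipal]

theorem le_iff_le_head {p s : EpsTerm α} (hp : p.IsPrincipal) (hs : s.IsNF) :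
    Le p s ↔ Le p s.head := by
  cases p with
  | eps x =>
    constructor
    · rintro ⟨y, hy, hy'⟩
      obtain ⟨z, hz, hz'⟩ := (occurs_aux s hs).1 y hy'
      exact ⟨z, hy.trans hz, hz'⟩
    · rintro ⟨y, hy, hy'⟩
      exact ⟨y, hy, hy'.of_head⟩
  | omega t =>
    cases s with
    | add q s =>
      have hq := hs.1
      cases q <;> simp_all [Le, head, IsPrincipal]
    | _ => simp [head]
  | _ => exact hp.elim

/-- The order is lexicographic in the summands. -/
theorem le_iff_lex {t s : EpsTerm α} (ht : t.IsNF) (hs : s.IsNF) (ht0 : t ≠ zero)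
    (hs0 : s ≠ zero) :
    Le t s ↔ (Le t.head s.head ∧ t.head ≠ s.head) ∨ (t.head = s.head ∧ Le t.tail s.tail) := by
  have principal : ∀ p : EpsTerm α, p.IsNF → p.IsPrincipal → p.head = p → p.tail = zero →
      (Le p s ↔ (Le p.head s.head ∧ p.head ≠ s.head) ∨
        (p.head = s.head ∧ Le p.tail s.tail)) := by
    intro p hpn hp h1 h2
    rw [le_iff_le_head hp hs, h1, h2]
    by_cases h : p = s.head
    · subst h
      simp [le_refl _ hpn, Le]
    · simp [h]
  cases t with
  | zero => exact (ht0 rfl).elim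
  | eps x => exact principal _ ht trivial rfl rfl
  | omega t => exact principal _ ht trivial rfl rfl
  | add p t =>
    cases s with
    | add q s => simp only [Le, head, tail]
    | _ =>
      simp only [Le, head, tail, or_false]
      refine ⟨Or.inl, ?_⟩
      rintro (h | ⟨-, h⟩)
      · exact h
      · exact (ht.2.2.2.1 (not_le_zero ht.2.2.1 h)).elim

theorem le_iff_exponent {p q : EpsTerm α} (hp : p.IsPrincipal) (hq : q.IsPrincipal) :
    Le p q ↔ Le p.exponent q.exponent := by
  cases p <;> cases q <;> simp_all [Le, head, exponent, Occurs, IsPrincipal]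

theorem exponent_inj {p q : EpsTerm α} (hp : p.IsPrincipal) (hq : q.IsPrincipal)
    (hpn : p.IsNF) (hqn : q.IsNF) (h : p.exponent = q.exponent) : p = q := by
  cases p <;> cases q <;> simp_all [exponent, IsPrincipal, IsNF]
  exact absurd h.symm (hqn.2 _)

/-- Either a term decomposes into shorter summands, or it is a constant, or it is a power. -/
theorem shape (t : EpsTerm α) (ht : t.IsNF) (h0 : t ≠ zero) :
    t.head.size < t.size ∨
      (t.IsPrincipal ∧ (t.exponent.size < t.size ∨ ∃ x, t = eps x)) := by
  cases t with
  | zero => exact (h0 rfl).elim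
  | eps x => exact Or.inr ⟨trivial, Or.inr ⟨x, rfl⟩⟩
  | omega t => exact Or.inr ⟨trivial, Or.inl (by simp [exponent, size])⟩
  | add p t => exact Or.inl (by simp only [head, size]; omega)

theorem le_antisymm' (n : ℕ) : ∀ t s : EpsTerm α, t.size + s.size ≤ n → t.IsNF → s.IsNF →
    Le t s → Le s t → t = s := by
  induction n using Nat.strong_induction_on with
  | _ n ih =>
  intro t s hn ht hs hts hst
  by_cases ht0 : t = zero
  · subst ht0; exact (not_le_zero hs hst).symm
  by_cases hs0 : s = zero
  · subst hs0; exact not_le_zero ht hts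
  have l1 := size_head_le t
  have l2 := size_head_le s
  have l3 := size_exponent_le t
  have l4 := size_exponent_le s
  have l5 := size_tail_lt ht0
  have l6 := size_tail_lt hs0
  by_cases hlt : t.head.size + s.head.size < n
  · rw [le_iff_lex ht hs ht0 hs0] at hts
    rw [le_iff_lex hs ht hs0 ht0] at hst
    have e1 : t.head = s.head := by
      rcases hts with hts | hts
      · rcases hst with hst | hst
        · exact ih _ hlt _ _ le_rfl ht.head hs.head hts.1 hst.1
        · exact hst.1.symm
      · exact hts.1
    have e2 : t.tail = s.tail :=
      ih _ (by omega) _ _ le_rfl ht.tail hs.tail (by simpa [e1] using hts) (by simpa [e1] using hst)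
    have := ht
    cases t <;> cases s <;> simp_all [head, tail, IsNF, IsPrincipal]
  · rcases shape t ht ht0 with h | ⟨hp, h⟩
    · omega
    rcases shape s hs hs0 with h' | ⟨hq, h'⟩
    · omega
    by_cases he : t.exponent.size + s.exponent.size < n
    · exact exponent_inj hp hq ht hs (ih _ he _ _ le_rfl ht.exponent hs.exponent
        ((le_iff_exponent hp hq).1 hts) ((le_iff_exponent hq hp).1 hst))
    · obtain ⟨x, rfl⟩ := h.resolve_left (by omega)
      obtain ⟨y, rfl⟩ := h'.resolve_left (by omega)
      simp only [Le, Occurs, exists_eq_right] at hts hst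
      rw [le_antisymm hts hst]

theorem le_total' (n : ℕ) : ∀ t s : EpsTerm α, t.size + s.size ≤ n → t.IsNF → s.IsNF →
    Le t s ∨ Le s t := by
  induction n using Nat.strong_induction_on with
  | _ n ih =>
  intro t s hn ht hs
  by_cases ht0 : t = zero
  · subst ht0; exact Or.inl trivial
  by_cases hs0 : s = zero
  · subst hs0; exact Or.inr trivial
  have l1 := size_head_le t
  have l2 := size_head_le s
  have l3 := size_exponent_le t
  have l4 := size_exponent_le s
  have l5 := size_tail_lt ht0
  have l6 := size_tail_lt hs0
  by_cases hlt : t.head.size + s.head.size < n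
  · rw [le_iff_lex ht hs ht0 hs0, le_iff_lex hs ht hs0 ht0]
    have h1 := ih _ hlt _ _ le_rfl ht.head hs.head
    have h2 := ih (t.tail.size + s.tail.size) (by omega) _ _ le_rfl ht.tail hs.tail
    by_cases e : t.head = s.head
    · simpa [e] using h2
    · simpa [e, Ne.symm e] using h1
  · rcases shape t ht ht0 with h | ⟨hp, h⟩
    · omega
    rcases shape s hs hs0 with h' | ⟨hq, h'⟩
    · omega
    rw [le_iff_exponent hp hq, le_iff_exponent hq hp]
    by_cases he : t.exponent.size + s.exponent.size < n
    · exact ih _ he _ _ le_rfl ht.exponent hs.exponent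
    · obtain ⟨x, rfl⟩ := h.resolve_left (by omega)
      obtain ⟨y, rfl⟩ := h'.resolve_left (by omega)
      simpa [exponent, Le, Occurs] using le_total x y

theorem le_trans' (n : ℕ) : ∀ t s r : EpsTerm α, t.size + s.size + r.size ≤ n →
    t.IsNF → s.IsNF → r.IsNF → Le t s → Le s r → Le t r := by
  induction n using Nat.strong_induction_on with
  | _ n ih =>
  intro t s r hn ht hs hr hts hsr
  by_cases ht0 : t = zero
  · subst ht0; trivial
  by_cases hs0 : s = zero
  · subst hs0; exact (ht0 (not_le_zero ht hts)).elim
  by_cases hr0 : r = zero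
  · subst hr0; exact (hs0 (not_le_zero hs hsr)).elim
  have l1 := size_head_le t
  have l2 := size_head_le s
  have l3 := size_exponent_le t
  have l4 := size_exponent_le s
  have l5 := size_tail_lt ht0
  have l6 := size_tail_lt hs0
  have l7 := size_head_le r
  have l8 := size_exponent_le r
  have l9 := size_tail_lt hr0
  by_cases hlt : t.head.size + s.head.size + r.head.size < n
  · rw [le_iff_lex ht hs ht0 hs0] at hts
    rw [le_iff_lex hs hr hs0 hr0] at hsr
    rw [le_iff_lex ht hr ht0 hr0]
    have h1 := ih _ hlt _ _ _ le_rfl ht.head hs.head hr.head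
    have h2 := ih (t.tail.size + s.tail.size + r.tail.size) (by omega) _ _ _ le_rfl
      ht.tail hs.tail hr.tail
    rcases hts with ⟨a, a'⟩ | ⟨a, a'⟩ <;> rcases hsr with ⟨b, b'⟩ | ⟨b, b'⟩
    · refine Or.inl ⟨h1 a b, fun e => b' ?_⟩
      rw [e] at a
      exact le_antisymm' _ _ _ le_rfl hs.head hr.head b a
    · exact Or.inl (b ▸ ⟨a, a'⟩)
    · exact Or.inl (a ▸ ⟨b, b'⟩)
    · exact Or.inr ⟨a.trans b, h2 a' b'⟩
  · rcases shape t ht ht0 with h | ⟨hp, h⟩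
    · omega
    rcases shape s hs hs0 with h' | ⟨hq, h'⟩
    · omega
    rcases shape r hr hr0 with h'' | ⟨hu, h''⟩
    · omega
    rw [le_iff_exponent hp hq] at hts
    rw [le_iff_exponent hq hu] at hsr
    rw [le_iff_exponent hp hu]
    by_cases he : t.exponent.size + s.exponent.size + r.exponent.size < n
    · exact ih _ he _ _ _ le_rfl ht.exponent hs.exponent hr.exponent hts hsr
    · obtain ⟨x, rfl⟩ := h.resolve_left (by omega)
      obtain ⟨y, rfl⟩ := h'.resolve_left (by omega)
      obtain ⟨z, rfl⟩ := h''.resolve_left (by omega)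
      simp only [exponent, Le, Occurs, exists_eq_right] at hts hsr ⊢
      exact hts.trans hsr

end Order

end EpsTerm

/-- The ordering `ε_X`: the terms over `X` that are in normal form, ordered by `EpsTerm.Le`. -/
def EpsOrder (α : Type*) [LinearOrder α] : Type _ := {t : EpsTerm α // t.IsNF}

open Classical in
noncomputable instance EpsOrder.instLinearOrder {α : Type*} [LinearOrder α] :
    LinearOrder (EpsOrder α) where
  le t s := EpsTerm.Le t.1 s.1
  le_refl t := EpsTerm.le_refl t.1 t.2
  le_trans t s r := EpsTerm.le_trans' _ _ _ _ le_rfl t.2 s.2 r.2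
  le_antisymm t s h h' := Subtype.ext (EpsTerm.le_antisymm' _ _ _ le_rfl t.2 s.2 h h')
  le_total t s := EpsTerm.le_total' _ _ _ le_rfl t.2 s.2
  toDecidableLE := Classical.decRel _

/-- The numbering of `ε_X` by the Gödel numbers of terms, given a numbering of `X`. -/
def EpsOrder.numbering {α : Type*} [LinearOrder α] (ν : α ↪ ℕ) : EpsOrder α ↪ ℕ where
  toFun t := t.1.code ν
  inj' := (EpsTerm.code_injective ν.injective).comp Subtype.val_injective

/-! Read a normal form as a weakly decreasing sequence of summands, padded with zeros; the order is
then lexicographic. For a descending sequence `a`, let `pos a k` be the place where `a k` and `a (k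
+ 1)` first differ. At the true stages, where no later difference lies further left, the differing
summands strictly descend, and so do their exponents; these form `derived a` (`derived_strictAnti`).
Being a true stage is a Π₁ condition, so one Turing jump computes `derived a`, uniformly in a
program for `a` (`exists_code_derived`). Hence `Z^(ω)` computes the first member b_n of the n-th
iterated derived sequence, uniformly in n (`uniformlyComputable_iterate_derived`).

Each derivation also strips an exponential: b_{n+1} is at most the exponent of the second member of
the n-th iterate. Following leading exponents from b_n ends in 0 or in a constant, and 0 is
impossible because some b_{n+m} would have nothing below it. So it ends, after k_n steps, in
ε_{x_n}, where x_n is the largest index occurring in b_n. The x_n weakly descend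
(`leading_antitone`). Moreover b_{n+k_n} ≤ ε_{x_n}, so the second member of that iterate is strictly
below ε_{x_n} and contains only smaller constants, whence x_{n+k_n+1} < x_n (`exists_leading_lt`).
Thinning out the x_n yields the descending sequence in X. -/

namespace OracleCode

/-! ### Programs with an oracle -/

/-- The program that computes a constant function. -/
def const : ℕ → OracleCode
  | 0 => zero
  | n + 1 => comp succ (const n)

/-- The program that computes the identity. -/
def ident : OracleCode := pair left right

@[simp] theorem eval_const (Z : ℕ → ℕ) (k n : ℕ) : (const k).eval Z n = Part.some k := by
  induction k with
  | zero => simp [const, eval]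
  | succ k ih => simp [const, eval, ih]

@[simp] theorem eval_ident (Z : ℕ → ℕ) (n : ℕ) : ident.eval Z n = Part.some n := by
  simp [ident, eval, Seq.seq]

theorem eval_comp {Z : ℕ → ℕ} {c d : OracleCode} {n m : ℕ} (h : d.eval Z n = Part.some m) :
    (comp c d).eval Z n = c.eval Z m :=
  (congrArg (fun p => p.bind (c.eval Z)) h).trans (Part.bind_some _ _)

theorem eval_pair {Z : ℕ → ℕ} {c d : OracleCode} {n a b : ℕ} (hc : c.eval Z n = Part.some a)
    (hd : d.eval Z n = Part.some b) : (pair c d).eval Z n = Part.some (Nat.pair a b) := by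
  simp [eval, hc, hd, Seq.seq]

theorem eval_prec_zero (Z : ℕ → ℕ) (c d : OracleCode) (a : ℕ) :
    (prec c d).eval Z (Nat.pair a 0) = c.eval Z a := by
  simp [eval]

theorem eval_prec_succ {Z : ℕ → ℕ} {c d : OracleCode} {a n i : ℕ}
    (h : (prec c d).eval Z (Nat.pair a n) = Part.some i) :
    (prec c d).eval Z (Nat.pair a (n + 1)) = d.eval Z (Nat.pair a (Nat.pair n i)) := by
  simp only [eval, Nat.unpair_pair] at h ⊢
  rw [h, Part.bind_eq_bind, Part.bind_some]

theorem mem_eval_rfind {Z : ℕ → ℕ} {c : OracleCode} {a : ℕ} {f : ℕ → ℕ}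
    (h : ∀ n, c.eval Z (Nat.pair a n) = Part.some (f n)) (m : ℕ) :
    m ∈ (rfind c).eval Z a ↔ f m = 0 ∧ ∀ k < m, f k ≠ 0 :=
  Nat.mem_rfind.trans (by simp [h])

theorem eval_rfind {Z : ℕ → ℕ} {c : OracleCode} {a : ℕ} {f : ℕ → ℕ}
    (h : ∀ n, c.eval Z (Nat.pair a n) = Part.some (f n)) (hf : ∃ n, f n = 0) :
    (rfind c).eval Z a = Part.some (sInf {n | f n = 0}) := by
  rw [Part.eq_some_iff, mem_eval_rfind h]
  exact ⟨Nat.sInf_mem (s := {n | f n = 0}) hf, fun k hk =>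
    Nat.notMem_of_lt_sInf (s := {n | f n = 0}) hk⟩

theorem eval_rfind_dom {Z : ℕ → ℕ} {c : OracleCode} {a : ℕ} {f : ℕ → ℕ}
    (h : ∀ n, c.eval Z (Nat.pair a n) = Part.some (f n)) :
    ((rfind c).eval Z a).Dom ↔ ∃ n, f n = 0 := by
  refine ⟨fun hd => ?_, fun hf => by rw [eval_rfind h hf]; trivial⟩
  exact ⟨_, ((mem_eval_rfind h _).1 (Part.get_mem hd)).1⟩

/-- Primitive recursive functions have programs that do not use the oracle. -/
theorem exists_of_primrec {f : ℕ → ℕ} (hf : Nat.Primrec f) :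
    ∃ c : OracleCode, ∀ Z n, c.eval Z n = Part.some (f n) := by
  induction hf with
  | zero => exact ⟨zero, fun _ _ => rfl⟩
  | succ => exact ⟨succ, fun _ _ => rfl⟩
  | left => exact ⟨left, fun _ _ => rfl⟩
  | right => exact ⟨right, fun _ _ => rfl⟩
  | pair _ _ ihf ihg =>
    obtain ⟨c, hc⟩ := ihf
    obtain ⟨d, hd⟩ := ihg
    exact ⟨pair c d, fun Z n => eval_pair (hc Z n) (hd Z n)⟩
  | comp _ _ ihf ihg =>
    obtain ⟨c, hc⟩ := ihf
    obtain ⟨d, hd⟩ := ihg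
    exact ⟨comp c d, fun Z n => (eval_comp (hd Z n)).trans (hc Z _)⟩
  | @prec f g _ _ ihf ihg =>
    obtain ⟨c, hc⟩ := ihf
    obtain ⟨d, hd⟩ := ihg
    refine ⟨prec c d, fun Z p => ?_⟩
    rw [← Nat.pair_unpair p]
    generalize p.unpair.1 = a, p.unpair.2 = n
    simp only [Nat.unpaired, Nat.unpair_pair]
    induction n with
    | zero => exact (eval_prec_zero Z c d a).trans (hc Z a)
    | succ n ih => exact (eval_prec_succ ih).trans (hd Z _)

theorem exists_of_recursiveIn {Z : ℕ → ℕ} {f : ℕ →. ℕ}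
    (hf : Nat.RecursiveIn {(Z : ℕ →. ℕ)} f) : ∃ c : OracleCode, c.eval Z = f := by
  induction hf with
  | zero => exact ⟨zero, rfl⟩
  | succ => exact ⟨succ, rfl⟩
  | left => exact ⟨left, rfl⟩
  | right => exact ⟨right, rfl⟩
  | oracle g hg => exact ⟨oracle, by rw [Set.mem_singleton_iff.1 hg]; rfl⟩
  | pair _ _ ihf ihg =>
    obtain ⟨c, rfl⟩ := ihf
    obtain ⟨d, rfl⟩ := ihg
    exact ⟨pair c d, rfl⟩
  | comp _ _ ihf ihg =>
    obtain ⟨c, rfl⟩ := ihf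
    obtain ⟨d, rfl⟩ := ihg
    exact ⟨comp c d, rfl⟩
  | prec _ _ ihf ihg =>
    obtain ⟨c, rfl⟩ := ihf
    obtain ⟨d, rfl⟩ := ihg
    exact ⟨prec c d, rfl⟩
  | rfind _ ihf =>
    obtain ⟨c, rfl⟩ := ihf
    exact ⟨rfind c, rfl⟩

theorem recursiveIn_eval (Z : ℕ → ℕ) (c : OracleCode) :
    Nat.RecursiveIn {(Z : ℕ →. ℕ)} (c.eval Z) := by
  induction c with
  | zero => exact .zero
  | succ => exact .succ
  | left => exact .left
  | right => exact .right
  | oracle => exact .oracle _ rfl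
  | pair _ _ ihf ihg => exact .pair ihf ihg
  | comp _ _ ihf ihg => exact .comp ihf ihg
  | prec _ _ ihf ihg => exact .prec ihf ihg
  | rfind _ ihf => exact .rfind ihf

end OracleCode

/-- The jump speaks of Gödel numbers, so reducibilities have to be traded for explicit programs. -/
theorem computableFrom_iff_exists_code {Z f : ℕ → ℕ} :
    ComputableFrom Z f ↔ ∃ c : OracleCode, ∀ n, c.eval Z n = Part.some (f n) := by
  rw [ComputableFrom, TuringReducible, RecursiveIn.iff_nat]
  constructor
  · intro h
    obtain ⟨c, hc⟩ := OracleCode.exists_of_recursiveIn h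
    exact ⟨c, fun n => by rw [hc]; rfl⟩
  · rintro ⟨c, hc⟩
    have := OracleCode.recursiveIn_eval Z c
    rwa [show c.eval Z = (f : ℕ →. ℕ) from funext hc] at this

/-! ### Uniform computability -/

/-- A single program computes `g i` from the input `x i` with the oracle `O i`, for all `i`. -/
def UniformlyComputable {ι : Type*} (O : ι → ℕ → ℕ) (x g : ι → ℕ) : Prop :=
  ∃ c : OracleCode, ∀ i, c.eval (O i) (x i) = Part.some (g i)

/-- Uniform computability of a function with an additional numerical argument. -/
def UniformlyComputable₂ {ι : Type*} (O : ι → ℕ → ℕ) (x : ι → ℕ) (g : ι → ℕ → ℕ) : Prop :=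
  UniformlyComputable (fun p : ι × ℕ => O p.1) (fun p => Nat.pair (x p.1) p.2)
    (fun p => g p.1 p.2)

namespace UniformlyComputable

variable {ι κ : Type*} {O : ι → ℕ → ℕ} {x y g h : ι → ℕ} {F : ι → ℕ → ℕ}

theorem input : UniformlyComputable O x x :=
  ⟨.ident, fun _ => OracleCode.eval_ident _ _⟩

theorem const (k : ℕ) : UniformlyComputable O x fun _ => k :=
  ⟨.const k, fun _ => OracleCode.eval_const _ _ _⟩

theorem oracle : UniformlyComputable₂ O x fun i n => O i n :=
  ⟨.comp .oracle .right, fun _ => by simp [OracleCode.eval]⟩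

theorem arg : UniformlyComputable₂ O x fun _ n => n :=
  ⟨.right, fun _ => by simp [OracleCode.eval]⟩

theorem trans (hy : UniformlyComputable O x y) (hg : UniformlyComputable O y g) :
    UniformlyComputable O x g := by
  obtain ⟨c, hc⟩ := hy
  obtain ⟨d, hd⟩ := hg
  exact ⟨.comp d c, fun i => (OracleCode.eval_comp (hc i)).trans (hd i)⟩

/-- The index reaches the program only through its oracle and its input, so the same program serves
any family pulled back along `r`. -/
theorem reindex (hg : UniformlyComputable O x g) (r : κ → ι) :
    UniformlyComputable (fun k => O (r k)) (fun k => x (r k)) fun k => g (r k) :=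
  hg.imp fun _ hc k => hc (r k)

theorem pair (hg : UniformlyComputable O x g) (hh : UniformlyComputable O x h) :
    UniformlyComputable O x fun i => Nat.pair (g i) (h i) := by
  obtain ⟨c, hc⟩ := hg
  obtain ⟨d, hd⟩ := hh
  exact ⟨.pair c d, fun i => OracleCode.eval_pair (hc i) (hd i)⟩

theorem primrec {f : ℕ → ℕ} (hf : Primrec f) (hg : UniformlyComputable O x g) :
    UniformlyComputable O x fun i => f (g i) := by
  obtain ⟨c, hc⟩ := OracleCode.exists_of_primrec (Primrec.nat_iff.1 hf)
  exact hg.trans ⟨c, fun _ => hc _ _⟩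

theorem primrec₂ {f : ℕ → ℕ → ℕ} (hf : Primrec₂ f) (hg : UniformlyComputable O x g)
    (hh : UniformlyComputable O x h) : UniformlyComputable O x fun i => f (g i) (h i) := by
  simpa using (hg.pair hh).primrec
    (hf.comp (Primrec.fst.comp Primrec.unpair) (Primrec.snd.comp Primrec.unpair))

/-- A function without the additional argument. -/
theorem weaken (hg : UniformlyComputable O x g) : UniformlyComputable₂ O x fun i _ => g i := by
  obtain ⟨c, hc⟩ := hg
  exact ⟨.comp c .left, fun i => (OracleCode.eval_comp (by simp [OracleCode.eval])).trans
    (hc i.1)⟩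

theorem apply (hF : UniformlyComputable₂ O x F) (hg : UniformlyComputable O x g) :
    UniformlyComputable O x fun i => F i (g i) :=
  (input.pair hg).trans (hF.reindex fun i => (i, g i))

theorem apply₂ {G : ι → ℕ → ℕ} (hF : UniformlyComputable₂ O x F)
    (hG : UniformlyComputable₂ O x G) : UniformlyComputable₂ O x fun i n => F i (G i n) := by
  have h1 : UniformlyComputable (fun p : ι × ℕ => O p.1) (fun p => Nat.pair (x p.1) p.2)
      fun p => Nat.pair (x p.1) (G p.1 p.2) := input.weaken.pair hG
  exact h1.trans (hF.reindex fun p : ι × ℕ => (p.1, G p.1 p.2))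

theorem sInf (hF : UniformlyComputable₂ O x F) (h0 : ∀ i, ∃ n, F i n = 0) :
    UniformlyComputable O x fun i => sInf {n | F i n = 0} := by
  obtain ⟨c, hc⟩ := hF
  exact ⟨.rfind c, fun i => OracleCode.eval_rfind (fun n => hc (i, n)) (h0 i)⟩

theorem rec {b : ι → ℕ} {s : ι → ℕ → ℕ} (hb : UniformlyComputable O x b)
    (hs : UniformlyComputable₂ O x s) :
    UniformlyComputable₂ O x fun i n => (s i)^[n] (b i) := by
  obtain ⟨c, hc⟩ := hb
  obtain ⟨d, hd⟩ := hs
  -- Primitive recursion hands over the input, the counter and the previous value; the counter is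
  -- dropped, since the step is a plain iteration.
  refine ⟨.prec c (.comp d (.pair .left (.comp .right .right))), fun ⟨i, n⟩ => ?_⟩
  simp only
  induction n with
  | zero => rw [OracleCode.eval_prec_zero, hc]; rfl
  | succ n ih =>
    rw [OracleCode.eval_prec_succ ih, Function.iterate_succ_apply']
    exact (OracleCode.eval_comp (by simp [OracleCode.eval, Seq.seq])).trans (hd (i, _))

end UniformlyComputable

/-! ### Descending sequences in `ε_X` -/

namespace EpsTerm

variable {α : Type*}

/-- The Gödel number of the first summand. -/
def headNum (m : ℕ) : ℕ := if m % 3 = 2 then (m / 3).unpair.1 else m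

/-- The Gödel number of the sum of the remaining summands. -/
def tailNum (m : ℕ) : ℕ := if m % 3 = 2 then (m / 3).unpair.2 else 0

/-- The Gödel number of the exponent of a principal term. -/
def exponentNum (m : ℕ) : ℕ := if m % 3 = 0 then m / 3 - 1 else m

theorem code_head (ν : α → ℕ) (t : EpsTerm α) : t.head.code ν = headNum (t.code ν) := by
  cases t with
  | add s t =>
    change s.code ν = headNum (3 * Nat.pair (s.code ν) (t.code ν) + 2)
    rw [headNum, if_pos (by omega), Nat.mul_add_div (by omega)]
    simp
  | _ => exact (if_neg (by simp only [code]; omega)).symm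

theorem code_tail (ν : α → ℕ) (t : EpsTerm α) : t.tail.code ν = tailNum (t.code ν) := by
  cases t with
  | add s t =>
    change t.code ν = tailNum (3 * Nat.pair (s.code ν) (t.code ν) + 2)
    rw [tailNum, if_pos (by omega), Nat.mul_add_div (by omega)]
    simp
  | _ => exact (if_neg (by simp only [code]; omega)).symm

theorem code_exponent (ν : α → ℕ) (t : EpsTerm α) :
    t.exponent.code ν = exponentNum (t.code ν) := by
  cases t with
  | zero => simp [exponent, code, exponentNum]
  | omega t =>
    change t.code ν = exponentNum (3 * t.code ν + 3)
    rw [exponentNum, if_pos (by omega)]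
    omega
  | _ => exact (if_neg (by simp only [code]; omega)).symm

/-- A nonzero term without proper summands or exponents is a constant. -/
theorem exists_eq_eps_of_size_le {t : EpsTerm α} (h0 : t ≠ zero)
    (h : t.size ≤ t.head.exponent.size) : ∃ x, t = eps x := by
  cases t with
  | zero => exact (h0 rfl).elim
  | eps x => exact ⟨x, rfl⟩
  | omega t => simp [head, exponent, size] at h
  | add p t =>
    have := size_exponent_le p
    simp only [head, size] at h
    omega

variable [LinearOrder α]

theorem IsNF.isPrincipal_head {t : EpsTerm α} (ht : t.IsNF) (h0 : t.head ≠ zero) :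
    t.head.IsPrincipal := by
  cases t <;> simp_all [EpsTerm.head, IsNF, IsPrincipal]

theorem IsNF.head_eq_zero {t : EpsTerm α} (ht : t.IsNF) : t.head = zero ↔ t = zero := by
  cases t <;> simp [EpsTerm.head]
  rintro rfl
  exact ht.1

theorem IsNF.head_tail_le {t : EpsTerm α} (ht : t.IsNF) : Le t.tail.head t.head := by
  cases t with
  | add p t => exact ht.2.2.2.2
  | _ => trivial

/-- Normality rules out a trailing summand 0, which would otherwise be confused with the default
value of `tail`. -/
theorem IsNF.ext_head_tail {t s : EpsTerm α} (ht : t.IsNF) (hs : s.IsNF) (h : t.head = s.head)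
    (h' : t.tail = s.tail) : t = s := by
  cases t <;> cases s <;> simp_all [EpsTerm.head, EpsTerm.tail, IsNF, IsPrincipal]

end EpsTerm

/-! ### Normal forms as lexicographically ordered sequences of summands -/

namespace EpsOrder

open EpsTerm (Occurs)

variable {α : Type*} [LinearOrder α]

/-- The zero of `ε_X`. -/
def zero : EpsOrder α := ⟨.zero, trivial⟩

/-- The element `ε_x` of `ε_X`. -/
def eps (x : α) : EpsOrder α := ⟨.eps x, trivial⟩

/-- The first summand. -/
def head (t : EpsOrder α) : EpsOrder α := ⟨t.1.head, t.2.head⟩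

/-- The sum of the remaining summands. -/
def tail (t : EpsOrder α) : EpsOrder α := ⟨t.1.tail, t.2.tail⟩

/-- The exponent of the first summand. -/
def exponent (t : EpsOrder α) : EpsOrder α := ⟨t.1.head.exponent, t.2.head.exponent⟩

/-- The summand number `l`. -/
def summand (t : EpsOrder α) (l : ℕ) : EpsOrder α := (tail^[l] t).head

theorem eq_iff_val_eq {s t : EpsOrder α} : s = t ↔ s.1 = t.1 := Subtype.ext_iff

theorem zero_le (t : EpsOrder α) : zero ≤ t := trivial

theorem eps_le_iff {x : α} {t : EpsOrder α} : eps x ≤ t ↔ ∃ y, x ≤ y ∧ Occurs y t.1 := Iff.rfl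

theorem exists_occurs_of_le {s t : EpsOrder α} (h : s ≤ t) {x : α} (hx : Occurs x s.1) :
    ∃ y, x ≤ y ∧ Occurs y t.1 :=
  (EpsTerm.occurs_aux s.1 s.2).2.1 _ h _ hx

theorem head_eq_zero {t : EpsOrder α} : t.head = zero ↔ t = zero := by
  rw [eq_iff_val_eq, eq_iff_val_eq]
  exact t.2.head_eq_zero

theorem ext_head_tail {s t : EpsOrder α} (h : s.head = t.head) (h' : s.tail = t.tail) : s = t :=
  Subtype.ext (s.2.ext_head_tail t.2 (congrArg Subtype.val h) (congrArg Subtype.val h'))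

theorem le_iff_lex {s t : EpsOrder α} (hs : s ≠ zero) (ht : t ≠ zero) :
    s ≤ t ↔ s.head < t.head ∨ (s.head = t.head ∧ s.tail ≤ t.tail) := by
  rw [lt_iff_le_and_ne, Ne, eq_iff_val_eq]
  exact EpsTerm.le_iff_lex s.2 t.2 (fun h => hs (Subtype.ext h)) fun h => ht (Subtype.ext h)

theorem eq_zero_of_le_zero {t : EpsOrder α} (h : t ≤ zero) : t = zero :=
  le_antisymm h (zero_le t)

theorem head_mono : Monotone (head : EpsOrder α → EpsOrder α) := by
  intro s t h
  by_cases hs : s = zero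
  · subst hs; exact zero_le _
  by_cases ht : t = zero
  · subst ht; exact (hs (eq_zero_of_le_zero h)).elim
  rcases (le_iff_lex hs ht).1 h with h | h
  exacts [h.le, h.1.le]

theorem tail_le_tail {s t : EpsOrder α} (h : s ≤ t) (hh : s.head = t.head) : s.tail ≤ t.tail := by
  by_cases hs : s = zero
  · subst hs; exact zero_le _
  by_cases ht : t = zero
  · subst ht; exact (hs (eq_zero_of_le_zero h)).elim
  rcases (le_iff_lex hs ht).1 h with h | h
  exacts [(h.ne hh).elim, h.2]

theorem exponent_le_exponent {s t : EpsOrder α} (h : s.head ≤ t.head) :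
    s.exponent ≤ t.exponent := by
  by_cases hs : s.head = zero
  · rw [head_eq_zero] at hs; subst hs; exact zero_le _
  by_cases ht : t.head = zero
  · rw [ht] at h; exact (hs (eq_zero_of_le_zero h)).elim
  exact (EpsTerm.le_iff_exponent (s.2.isPrincipal_head fun e => hs (Subtype.ext e))
    (t.2.isPrincipal_head fun e => ht (Subtype.ext e))).1 h

theorem exponent_mono : Monotone (exponent : EpsOrder α → EpsOrder α) :=
  fun _ _ h => exponent_le_exponent (head_mono h)

/-- Strictness comes from `exponent_inj`, as ω^{ε_x} is not normal. The term 0 is excluded because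
it has the same exponent as ω^0. -/
theorem exponent_lt_exponent {s t : EpsOrder α} (h : s.head < t.head) (hs : s ≠ zero) :
    s.exponent < t.exponent := by
  refine (exponent_le_exponent h.le).lt_of_ne fun e => h.ne (Subtype.ext ?_)
  rw [Ne, ← head_eq_zero] at hs
  have ht : t.head ≠ zero := fun ht => hs (eq_zero_of_le_zero (ht ▸ h.le))
  exact EpsTerm.exponent_inj (s.2.isPrincipal_head fun e => hs (Subtype.ext e))
    (t.2.isPrincipal_head fun e => ht (Subtype.ext e)) s.2.head t.2.head (congrArg Subtype.val e)

theorem summand_antitone (t : EpsOrder α) : Antitone t.summand := by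
  refine antitone_nat_of_succ_le fun l => ?_
  rw [summand, summand, Function.iterate_succ_apply']
  exact (tail^[l] t).2.head_tail_le

theorem iterate_tail_le {s t : EpsOrder α} (h : s ≤ t) {l : ℕ}
    (hl : ∀ i < l, s.summand i = t.summand i) : tail^[l] s ≤ tail^[l] t := by
  induction l with
  | zero => exact h
  | succ l ih =>
    rw [Function.iterate_succ_apply', Function.iterate_succ_apply']
    exact tail_le_tail (ih fun i hi => hl i (by omega)) (hl l (by omega))

/-- Lengths need no comparison: beyond the last summand the value is 0, which is never a genuine
summand. -/
theorem ext_summand {s t : EpsOrder α} (h : ∀ l, s.summand l = t.summand l) : s = t := by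
  induction hn : s.1.size using Nat.strong_induction_on generalizing s t with
  | _ n ih =>
  by_cases hs : s = zero
  · have h0 : s.head = t.head := h 0
    rw [hs] at h0 ⊢
    exact (head_eq_zero.1 h0.symm).symm
  · refine ext_head_tail (h 0) (ih _ ?_ (fun l => h (l + 1)) rfl)
    rw [← hn]
    exact EpsTerm.size_tail_lt fun e => hs (Subtype.ext e)

/-- The position of the first summand in which two terms differ. -/
noncomputable def diffPos (s t : EpsOrder α) : ℕ := sInf {l | s.summand l ≠ t.summand l}

theorem exists_summand_ne {s t : EpsOrder α} (h : s ≠ t) : ∃ l, s.summand l ≠ t.summand l := by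
  by_contra! h'
  exact h (ext_summand h')

theorem summand_eq_of_lt_diffPos {s t : EpsOrder α} {l : ℕ} (h : l < diffPos s t) :
    s.summand l = t.summand l := by
  by_contra h'
  exact Nat.notMem_of_lt_sInf h h'

theorem summand_diffPos_lt {s t : EpsOrder α} (h : t < s) :
    t.summand (diffPos s t) < s.summand (diffPos s t) := by
  refine lt_of_le_of_ne (head_mono (iterate_tail_le h.le fun i hi =>
    (summand_eq_of_lt_diffPos hi).symm)) ?_
  exact Ne.symm (Nat.sInf_mem (s := {l | s.summand l ≠ t.summand l}) (exists_summand_ne h.ne'))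

/-! #### The derived sequence -/

section Derived

variable (a : ℕ → EpsOrder α)

/-- The position in which the `k`-th and the next member of a sequence differ. -/
noncomputable def pos (k : ℕ) : ℕ := diffPos (a k) (a (k + 1))

/-- No later change occurs in an earlier position than the change at `k`. -/
def IsTrueStage (k : ℕ) : Prop := ∀ j, pos a k ≤ pos a (k + j)

/-- The least true stage after `k`. -/
noncomputable def nextTrueStage (k : ℕ) : ℕ := sInf {m | k < m ∧ IsTrueStage a m}

/-- The true stages in increasing order, without the stage `0`. -/
noncomputable def trueStage (n : ℕ) : ℕ := (nextTrueStage a)^[n + 1] 0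

/-- The sequence of the exponents that change at the true stages. -/
noncomputable def derived (n : ℕ) : EpsOrder α :=
  (tail^[pos a (trueStage a n)] (a (trueStage a n))).exponent

theorem exists_isTrueStage (k : ℕ) : ∃ m, k < m ∧ IsTrueStage a m := by
  -- A stage after `k` at which the position of change is least is true.
  obtain ⟨m, hm, hmin⟩ := exists_minimalFor_of_wellFoundedLT (fun m => k < m) (pos a)
    ⟨k + 1, Nat.lt_succ_self k⟩
  refine ⟨m, hm, fun j => ?_⟩
  rcases le_total (pos a m) (pos a (m + j)) with h | h
  exacts [h, hmin (by simp only at hm ⊢; omega) h]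

theorem nextTrueStage_spec (k : ℕ) : k < nextTrueStage a k ∧ IsTrueStage a (nextTrueStage a k) :=
  Nat.sInf_mem (exists_isTrueStage a k)

theorem trueStage_succ (n : ℕ) : trueStage a (n + 1) = nextTrueStage a (trueStage a n) :=
  Function.iterate_succ_apply' _ _ _

theorem isTrueStage_trueStage (n : ℕ) : IsTrueStage a (trueStage a n) := by
  rw [trueStage, Function.iterate_succ_apply']
  exact (nextTrueStage_spec a _).2

theorem trueStage_lt_succ (n : ℕ) : trueStage a n < trueStage a (n + 1) := by
  rw [trueStage_succ]
  exact (nextTrueStage_spec a _).1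

variable {a} (ha : StrictAnti a)
include ha

theorem summand_pos_lt (k : ℕ) : (a (k + 1)).summand (pos a k) < (a k).summand (pos a k) :=
  summand_diffPos_lt (ha (Nat.lt_succ_self k))

/-- After a true stage `k` the summands left of `pos a k` are frozen, so the summand at `pos a k`
drops once and never rises again. A later change lies at or to the right of it, where summands are
no larger. -/
theorem summand_pos_lt_of_isTrueStage {k m : ℕ} (hk : IsTrueStage a k) (hkm : k < m) :
    (a m).summand (pos a m) < (a k).summand (pos a k) := by
  obtain ⟨j, rfl⟩ := Nat.exists_eq_add_of_le (Nat.succ_le_of_lt hkm)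
  have agree : ∀ j, ∀ i < pos a k, (a (k + 1 + j)).summand i = (a (k + 1)).summand i := by
    intro j i hi
    induction j with
    | zero => rfl
    | succ j ih =>
      rw [← ih]
      refine (summand_eq_of_lt_diffPos (hi.trans_le ?_)).symm
      have := hk (1 + j)
      rwa [← add_assoc] at this
  calc (a (k + 1 + j)).summand (pos a (k + 1 + j))
      ≤ (a (k + 1 + j)).summand (pos a k) :=
        summand_antitone _ (add_assoc k 1 j ▸ hk (1 + j))
    _ ≤ (a (k + 1)).summand (pos a k) :=
        head_mono (iterate_tail_le (ha.antitone (by omega)) (agree j))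
    _ < (a k).summand (pos a k) := summand_pos_lt ha k

theorem derived_strictAnti : StrictAnti (derived a) := by
  refine strictAnti_nat_of_succ_lt fun n => exponent_lt_exponent
    (summand_pos_lt_of_isTrueStage ha (isTrueStage_trueStage a n) (trueStage_lt_succ a n)) ?_
  intro h
  -- The changing summand strictly decreases at this stage, so it is not 0.
  have := summand_pos_lt ha (trueStage a (n + 1))
  rw [summand, summand, h] at this
  exact this.not_ge (zero_le _)

/-- Leaving out stage 0 pays off here: the bound uses `a 1`, which is strictly below `a 0`, and
`exists_leading_lt` needs that gap. -/
theorem derived_le (n : ℕ) : derived a n ≤ (a 1).exponent := by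
  refine (exponent_le_exponent (t := a (trueStage a n)) ?_).trans
    (exponent_mono (ha.antitone ?_))
  · exact summand_antitone _ (Nat.zero_le _)
  · rw [trueStage, Function.iterate_succ_apply']
    exact (Nat.zero_le _).trans_lt (nextTrueStage_spec a _).1

end Derived

end EpsOrder

/-! ### Constants occurring in a term and in its iterated exponents -/

namespace EpsTerm

variable {α : Type*}

theorem Occurs.of_exponent {y : α} {t : EpsTerm α} (h : Occurs y t.exponent) : Occurs y t := by
  cases t <;> simp_all [EpsTerm.exponent, Occurs]

theorem Occurs.exponent {y : α} {t : EpsTerm α} (h : Occurs y t) : Occurs y t.exponent := by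
  cases t <;> simp_all [EpsTerm.exponent, Occurs]

end EpsTerm

namespace EpsOrder

open EpsTerm (Occurs)

variable {α : Type*} [LinearOrder α]

theorem occurs_of_exponent {y : α} {t : EpsOrder α} (h : Occurs y t.exponent.1) : Occurs y t.1 :=
  h.of_exponent.of_head

/-- In a normal form the first summand already contains the largest constant, so passing to the
leading exponent does not lose it. -/
theorem exists_occurs_exponent {y : α} {t : EpsOrder α} (h : Occurs y t.1) :
    ∃ z, y ≤ z ∧ Occurs z t.exponent.1 := by
  obtain ⟨z, hz, hz'⟩ := (EpsTerm.occurs_aux t.1 t.2).1 y h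
  exact ⟨z, hz, hz'.exponent⟩

theorem occurs_of_iterate_exponent {y : α} (m : ℕ) {t : EpsOrder α}
    (h : Occurs y (exponent^[m] t).1) : Occurs y t.1 := by
  induction m generalizing t with
  | zero => exact h
  | succ m ih => exact occurs_of_exponent (ih h)

theorem exists_occurs_iterate_exponent {y : α} (m : ℕ) {t : EpsOrder α} (h : Occurs y t.1) :
    ∃ z, y ≤ z ∧ Occurs z (exponent^[m] t).1 := by
  induction m generalizing t y with
  | zero => exact ⟨y, le_rfl, h⟩
  | succ m ih =>
    obtain ⟨z, hz, hz'⟩ := exists_occurs_exponent h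
    obtain ⟨w, hw, hw'⟩ := ih hz'
    exact ⟨w, hz.trans hw, hw'⟩

/-- Leading exponents shrink in size until 0 or a constant is reached. -/
theorem exists_iterate_exponent (t : EpsOrder α) :
    ∃ m, exponent^[m] t = zero ∨ ∃ x, exponent^[m] t = eps x := by
  induction hn : t.1.size using Nat.strong_induction_on generalizing t with
  | _ n ih =>
  by_cases h0 : t = zero
  · exact ⟨0, Or.inl h0⟩
  by_cases h : t.1.size ≤ t.exponent.1.size
  · obtain ⟨x, hx⟩ := EpsTerm.exists_eq_eps_of_size_le (fun e => h0 (Subtype.ext e)) h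
    exact ⟨0, Or.inr ⟨x, Subtype.ext hx⟩⟩
  · obtain ⟨m, hm⟩ := ih _ (hn ▸ not_le.1 h) t.exponent rfl
    exact ⟨m + 1, hm⟩

/-! #### Iterating the derived sequence -/

section Iterate

variable {a : ℕ → EpsOrder α} (ha : StrictAnti a)
include ha

theorem iterate_derived_strictAnti (n : ℕ) : StrictAnti (derived^[n] a) := by
  induction n with
  | zero => exact ha
  | succ n ih =>
    rw [Function.iterate_succ_apply']
    exact derived_strictAnti ih

theorem iterate_derived_succ_le (n : ℕ) :
    derived^[n + 1] a 0 ≤ (derived^[n] a 1).exponent := by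
  rw [Function.iterate_succ_apply']
  exact derived_le (iterate_derived_strictAnti ha n) 0

theorem iterate_derived_add_le (n m : ℕ) :
    derived^[n + m] a 0 ≤ exponent^[m] (derived^[n] a 0) := by
  induction m with
  | zero => exact le_rfl
  | succ m ih =>
    rw [Function.iterate_succ_apply']
    exact (iterate_derived_succ_le ha _).trans (exponent_mono
      (((iterate_derived_strictAnti ha _).antitone zero_le_one).trans ih))

theorem exists_iterate_exponent_derived (n : ℕ) :
    ∃ m x, exponent^[m] (derived^[n] a 0) = eps x := by
  obtain ⟨m, h | ⟨x, h⟩⟩ := exists_iterate_exponent (derived^[n] a 0)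
  · have h1 := iterate_derived_add_le ha n m
    have h2 := iterate_derived_strictAnti ha (n + m) zero_lt_one
    rw [h] at h1
    exact ((h2.trans_le h1).not_ge (zero_le _)).elim
  · exact ⟨m, x, h⟩

variable {k : ℕ → ℕ} {x : ℕ → α} (hx : ∀ n, exponent^[k n] (derived^[n] a 0) = eps (x n))
include hx

omit ha in
theorem occurs_leading (n : ℕ) : Occurs (x n) (derived^[n] a 0).1 :=
  occurs_of_iterate_exponent (k n) (by rw [hx]; rfl)

/-- Constants of the next first member are dominated by constants of the present one, and all of
these survive, up to domination, into ε_{x n}. -/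
theorem leading_antitone : Antitone x := by
  refine antitone_nat_of_succ_le fun n => ?_
  obtain ⟨y, hy, hy'⟩ := exists_occurs_of_le
    (iterate_derived_add_le ha n 1) (occurs_leading hx (n + 1))
  obtain ⟨z, hz, hz'⟩ := exists_occurs_iterate_exponent (k n) (occurs_of_iterate_exponent 1 hy')
  rw [hx] at hz'
  exact (hy.trans hz).trans_eq hz'

theorem exists_leading_lt (n : ℕ) : ∃ m, x m < x n := by
  -- After `k n` derivations the bound is ε_{x n} itself. One more derivation passes below the
  -- second member, which lies strictly under this bound.
  refine ⟨n + k n + 1, ?_⟩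
  by_contra! h
  obtain ⟨y, hy, hy'⟩ := exists_occurs_of_le (iterate_derived_succ_le ha _)
    (occurs_leading hx (n + k n + 1))
  have h1 : eps (x n) ≤ derived^[n + k n] a 1 :=
    eps_le_iff.2 ⟨y, h.trans hy, occurs_of_exponent hy'⟩
  have h2 := iterate_derived_add_le ha n (k n)
  rw [hx] at h2
  exact ((h2.trans h1).trans_lt (iterate_derived_strictAnti ha _ zero_lt_one)).false

end Iterate

end EpsOrder

/-! ### Queries to the Turing jump -/

/-- The Gödel number of a composition. -/
def compNum (m n : ℕ) : ℕ := 4 * Nat.pair m n + 6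

/-- The Gödel number of a paired program. -/
def pairNum (m n : ℕ) : ℕ := 4 * Nat.pair m n + 5

/-- The Gödel number of an unbounded search. -/
def rfindNum (m : ℕ) : ℕ := 4 * m + 8

/-- The Gödel number of the program for a constant function. -/
def constNum (n : ℕ) : ℕ := (OracleCode.const n).code

theorem primrec_compNum : Primrec₂ compNum :=
  (Primrec.nat_add.comp (Primrec.nat_mul.comp (.const 4) Primrec₂.natPair) (.const 6)).to₂

theorem primrec_pairNum : Primrec₂ pairNum :=
  (Primrec.nat_add.comp (Primrec.nat_mul.comp (.const 4) Primrec₂.natPair) (.const 5)).to₂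

theorem primrec_rfindNum : Primrec rfindNum :=
  Primrec.nat_add.comp (Primrec.nat_mul.comp (.const 4) .id) (.const 8)

theorem primrec_constNum : Primrec constNum := by
  refine (Primrec.nat_iterate .id (.const 0)
    (primrec_compNum.comp₂ (.const 1) Primrec₂.right)).of_eq fun n => ?_
  induction n with
  | zero => rfl
  | succ n ih =>
    simp only [id] at ih ⊢
    rw [Function.iterate_succ_apply', ih]
    rfl

open Classical in
theorem turingJump_code (Z : ℕ → ℕ) (c : OracleCode) :
    turingJump Z c.code = if (c.eval Z c.code).Dom then 1 else 0 := by
  unfold turingJump charFun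
  congr 1
  simp only [Set.mem_ofPred_eq, eq_iff_iff]
  constructor
  · rintro ⟨d, hd, h⟩
    obtain rfl := OracleCode.code_injective hd
    exact h
  · exact fun h => ⟨c, rfl, h⟩

namespace OracleCode

/-- The value of a program at a given argument is decided by the Turing jump of its oracle. -/
theorem exists_value_query : ∃ q : ℕ → ℕ → ℕ → ℕ,
    (Primrec fun p : ℕ × ℕ × ℕ => q p.1 p.2.1 p.2.2) ∧
    ∀ (Z : ℕ → ℕ) (c : OracleCode) (n v : ℕ), c.eval Z n = Part.some v →
      ∀ y, turingJump Z (q c.code n y) = if v = y then 1 else 0 := by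
  have hp : Primrec fun m : ℕ => if m.unpair.1.unpair.1 = m.unpair.1.unpair.2 then 0 else 1 := by
    have h1 : Primrec fun m : ℕ => m.unpair.1 := Primrec.fst.comp Primrec.unpair
    have h2 : Primrec fun m : ℕ => m.unpair.2 := Primrec.snd.comp Primrec.unpair
    exact Primrec.ite (Primrec.eq.comp (h1.comp h1) (h2.comp h1)) (.const 0) (.const 1)
  -- On input ⟨⟨v, y⟩, i⟩ this tests v = y and ignores the search variable i, so the search over i
  -- halts exactly when the two agree.
  obtain ⟨d, hd⟩ := exists_of_primrec (Primrec.nat_iff.1 hp)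
  refine ⟨fun e n y => compNum (rfind d).code (pairNum (compNum e (constNum n)) (constNum y)),
    ?_, fun Z c n v hv y => ?_⟩
  · have h1 : Primrec fun p : ℕ × ℕ × ℕ => p.2.1 := Primrec.fst.comp Primrec.snd
    have h2 : Primrec fun p : ℕ × ℕ × ℕ => p.2.2 := Primrec.snd.comp Primrec.snd
    exact primrec_compNum.comp (.const _) (primrec_pairNum.comp
      (primrec_compNum.comp .fst (primrec_constNum.comp h1)) (primrec_constNum.comp h2))
  · have key : ∀ m, ((comp (rfind d) (pair (comp c (const n)) (const y))).eval Z m).Dom ↔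
        v = y := by
      intro m
      rw [eval_comp (eval_pair ((eval_comp (eval_const Z n m)).trans hv) (eval_const Z y m)),
        eval_rfind_dom fun i => hd Z (Nat.pair (Nat.pair v y) i)]
      simp
    refine (turingJump_code Z (comp (rfind d) (pair (comp c (const n)) (const y)))).trans ?_
    simp only [key]

end OracleCode

namespace UniformlyComputable

variable {ι : Type*} {O : ι → ℕ → ℕ} {x : ι → ℕ}

theorem congr {g h : ι → ℕ} (hg : UniformlyComputable O x g) (H : ∀ i, g i = h i) :
    UniformlyComputable O x h :=
  funext H ▸ hg

/-- A function without the second additional argument. -/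
theorem weaken₂ {F : ι → ℕ → ℕ} (hF : UniformlyComputable₂ O x F) :
    UniformlyComputable₂ (fun p : ι × ℕ => O p.1) (fun p => Nat.pair (x p.1) p.2)
      fun p n => F p.1 n := by
  have h1 : UniformlyComputable₂ (fun p : ι × ℕ => O p.1) (fun p => Nat.pair (x p.1) p.2)
      fun p n => Nat.pair (x p.1) n := by
    refine UniformlyComputable.pair ?_
      (arg (O := fun p : ι × ℕ => O p.1) (x := fun p => Nat.pair (x p.1) p.2))
    exact (UniformlyComputable.input.weaken (O := O) (x := x)).weaken
  exact h1.trans (hF.reindex fun p : (ι × ℕ) × ℕ => (p.1.1, p.2))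

/-- Access to the Turing jump of the oracles of given programs suffices to run them. -/
theorem eval {Z : ι → ℕ → ℕ} {c : ι → OracleCode} {F : ι → ℕ → ℕ}
    (hF : ∀ i n, (c i).eval (Z i) n = Part.some (F i n))
    (hJ : UniformlyComputable₂ O x fun i n => turingJump (Z i) n)
    (hc : UniformlyComputable O x fun i => (c i).code) : UniformlyComputable₂ O x F := by
  obtain ⟨q, hq, hq'⟩ := OracleCode.exists_value_query
  -- Instead of running a universal program, one searches for the value `y` that the jump confirms.
  -- The subtraction turns a positive answer into the zero that a search looks for.
  have hv : ∀ (p : ι × ℕ) y, 1 - turingJump (Z p.1) (q (c p.1).code p.2 y) =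
      if F p.1 p.2 = y then 0 else 1 := by
    intro p y
    rw [hq' _ _ _ _ (hF p.1 p.2) y]
    split_ifs <;> rfl
  have h := UniformlyComputable.sInf (O := fun p : ι × ℕ => O p.1)
    (x := fun p => Nat.pair (x p.1) p.2)
    (F := fun p y => 1 - turingJump (Z p.1) (q (c p.1).code p.2 y)) ?_ ?_
  · refine h.congr fun p => ?_
    simp only [hv]
    simp
  · have h1 : Primrec fun m : ℕ => m.unpair.1 := Primrec.fst.comp Primrec.unpair
    have h2 : Primrec fun m : ℕ => m.unpair.2 := Primrec.snd.comp Primrec.unpair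
    have h3 := UniformlyComputable.primrec (hq.comp (h1.pair ((h1.comp h2).pair (h2.comp h2))))
      (UniformlyComputable.pair (weaken (weaken hc)) (UniformlyComputable.pair
        (weaken (arg (O := O) (x := x)))
        (arg (O := fun p : ι × ℕ => O p.1) (x := fun p => Nat.pair (x p.1) p.2))))
    simp only [Nat.unpair_pair] at h3
    exact UniformlyComputable.primrec (f := fun m => 1 - m)
      (Primrec.nat_sub.comp (.const 1) .id)
      (apply₂ (G := fun (p : ι × ℕ) y => q (c p.1).code p.2 y) (weaken₂ hJ) h3)
  · exact fun p => ⟨F p.1 p.2, by simp only [hv, if_true]⟩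

end UniformlyComputable

/-! ### Computing the derived sequence from the Turing jump -/

namespace EpsTerm

theorem primrec_ite_mod_three {f g : ℕ → ℕ} (r : ℕ) (hf : Primrec f) (hg : Primrec g) :
    Primrec fun m => if m % 3 = r then f m else g m :=
  Primrec.ite (Primrec.eq.comp (Primrec.nat_mod.comp .id (.const 3)) (.const r)) hf hg

theorem primrec_headNum : Primrec headNum :=
  primrec_ite_mod_three 2 (Primrec.fst.comp (Primrec.unpair.comp
    (Primrec.nat_div.comp .id (.const 3)))) .id

theorem primrec_tailNum : Primrec tailNum :=
  primrec_ite_mod_three 2 (Primrec.snd.comp (Primrec.unpair.comp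
    (Primrec.nat_div.comp .id (.const 3)))) (.const 0)

theorem primrec_exponentNum : Primrec exponentNum :=
  primrec_ite_mod_three 0 (Primrec.nat_sub.comp (Primrec.nat_div.comp .id (.const 3)) (.const 1))
    .id

end EpsTerm

namespace EpsOrder

variable {α : Type*} [LinearOrder α] {ν : α ↪ ℕ}

theorem numbering_tail (t : EpsOrder α) :
    numbering ν t.tail = EpsTerm.tailNum (numbering ν t) := t.1.code_tail ν

theorem numbering_head (t : EpsOrder α) :
    numbering ν t.head = EpsTerm.headNum (numbering ν t) := t.1.code_head ν

theorem numbering_exponent (t : EpsOrder α) :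
    numbering ν t.exponent = EpsTerm.exponentNum (EpsTerm.headNum (numbering ν t)) :=
  (t.1.head.code_exponent ν).trans (congrArg _ (t.1.code_head ν))

/-- Constants are the only terms whose Gödel number is 1 modulo 3. -/
theorem exists_eq_eps_of_numbering {t : EpsOrder α} (h : (numbering ν t + 2) % 3 = 0) :
    ∃ x, t = eps x := by
  obtain ⟨t, ht⟩ := t
  change (t.code ν + 2) % 3 = 0 at h
  cases t with
  | eps x => exact ⟨x, rfl⟩
  | _ => simp only [EpsTerm.code] at h; omega

section Computability

variable {ι : Type*} {O : ι → ℕ → ℕ} {x : ι → ℕ} {s t : ι → EpsOrder α}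

theorem uniformlyComputable_exponent (ht : UniformlyComputable O x fun i => numbering ν (t i)) :
    UniformlyComputable O x fun i => numbering ν (t i).exponent := by
  simp only [numbering_exponent]
  exact (ht.primrec EpsTerm.primrec_headNum).primrec EpsTerm.primrec_exponentNum

theorem uniformlyComputable_iterate_tail
    (ht : UniformlyComputable O x fun i => numbering ν (t i)) :
    UniformlyComputable₂ O x fun i l => numbering ν (tail^[l] (t i)) := by
  have h : ∀ (l : ℕ) (t : EpsOrder α),
      numbering ν (tail^[l] t) = EpsTerm.tailNum^[l] (numbering ν t) := fun l =>
    Function.Semiconj.iterate_right (f := numbering ν) numbering_tail l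
  simp only [h]
  exact ht.rec (s := fun _ => EpsTerm.tailNum)
    (UniformlyComputable.arg.primrec EpsTerm.primrec_tailNum)

theorem uniformlyComputable_iterate_exponent
    (ht : UniformlyComputable O x fun i => numbering ν (t i)) :
    UniformlyComputable₂ O x fun i l => numbering ν (exponent^[l] (t i)) := by
  have h : ∀ (l : ℕ) (t : EpsOrder α), numbering ν (exponent^[l] t) =
      (fun m => EpsTerm.exponentNum (EpsTerm.headNum m))^[l] (numbering ν t) := fun l =>
    Function.Semiconj.iterate_right (f := numbering ν) (ga := exponent)
      (gb := fun m => EpsTerm.exponentNum (EpsTerm.headNum m)) numbering_exponent l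
  simp only [h]
  exact ht.rec (s := fun _ m => EpsTerm.exponentNum (EpsTerm.headNum m))
    ((UniformlyComputable.arg.primrec EpsTerm.primrec_headNum).primrec EpsTerm.primrec_exponentNum)

theorem uniformlyComputable_summand (ht : UniformlyComputable O x fun i => numbering ν (t i)) :
    UniformlyComputable₂ O x fun i l => numbering ν ((t i).summand l) := by
  simp only [summand, numbering_head]
  exact (uniformlyComputable_iterate_tail ht).primrec EpsTerm.primrec_headNum

theorem uniformlyComputable_diffPos (hs : UniformlyComputable O x fun i => numbering ν (s i))
    (ht : UniformlyComputable O x fun i => numbering ν (t i)) (hst : ∀ i, s i ≠ t i) :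
    UniformlyComputable O x fun i => diffPos (s i) (t i) := by
  have hp : Primrec₂ fun m n : ℕ => if m = n then 1 else 0 :=
    Primrec.ite (Primrec.eq.comp .fst .snd) (.const 1) (.const 0)
  have h := UniformlyComputable.sInf (F := fun i l =>
    if numbering ν ((s i).summand l) = numbering ν ((t i).summand l) then 1 else 0)
    (UniformlyComputable.primrec₂ hp (uniformlyComputable_summand hs)
      (uniformlyComputable_summand ht)) fun i => ?_
  · refine h.congr fun i => ?_
    simp [diffPos]
  · obtain ⟨l, hl⟩ := exists_summand_ne (hst i)
    exact ⟨l, by simpa using hl⟩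

/-- Taking all oracles and all pairs of distinct terms as the index set turns uniformity into a
single program; distinctness makes its search halt. -/
theorem exists_code_diffPos (ν : α ↪ ℕ) : ∃ d : OracleCode, ∀ (Z : ℕ → ℕ) (s t : EpsOrder α),
    s ≠ t → d.eval Z (Nat.pair (numbering ν s) (numbering ν t)) = Part.some (diffPos s t) := by
  have h := uniformlyComputable_diffPos (ν := ν)
    (ι := {p : (ℕ → ℕ) × EpsOrder α × EpsOrder α // p.2.1 ≠ p.2.2})
    (O := fun p => p.1.1) (x := fun p => Nat.pair (numbering ν p.1.2.1) (numbering ν p.1.2.2))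
    (s := fun p => p.1.2.1) (t := fun p => p.1.2.2) ?_ ?_ fun p => p.2
  · obtain ⟨d, hd⟩ := h
    exact ⟨d, fun Z s t hst => hd ⟨(Z, s, t), hst⟩⟩
  · exact ⟨.left, fun p => by simp [OracleCode.eval]⟩
  · exact ⟨.right, fun p => by simp [OracleCode.eval]⟩

/-- The true stages of a sequence are decided by the Turing jump. -/
theorem exists_isTrueStage_query (ν : α ↪ ℕ) : ∃ q : ℕ → ℕ → ℕ, Primrec₂ q ∧
    ∀ (Z : ℕ → ℕ) (c : OracleCode) (a : ℕ → EpsOrder α), StrictAnti a →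
      (∀ n, c.eval Z n = Part.some (numbering ν (a n))) →
        ∀ k, turingJump Z (q c.code k) = 0 ↔ IsTrueStage a k := by
  obtain ⟨d, hd⟩ := exists_code_diffPos ν
  have hadd : Primrec fun m : ℕ => m.unpair.1 + m.unpair.2 :=
    Primrec.nat_add.comp (Primrec.fst.comp Primrec.unpair) (Primrec.snd.comp Primrec.unpair)
  have hlt : Primrec fun m : ℕ => if m.unpair.1 < m.unpair.2 then 0 else 1 :=
    Primrec.ite (Primrec.nat_lt.comp (Primrec.fst.comp Primrec.unpair)
      (Primrec.snd.comp Primrec.unpair)) (.const 0) (.const 1)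
  obtain ⟨f, hf⟩ := OracleCode.exists_of_primrec (Primrec.nat_iff.1 hadd)
  obtain ⟨g, hg⟩ := OracleCode.exists_of_primrec (Primrec.nat_iff.1 hlt)
  -- `P c` computes `pos a`, and `Pn` is the same construction on Gödel numbers. The query searches
  -- for some j with `pos a (k + j) < pos a k`, so it diverges exactly at true stages.
  let P (c : OracleCode) : OracleCode := .comp d (.pair c (.comp c .succ))
  let Pn (e : ℕ) : ℕ := compNum d.code (pairNum e (compNum e OracleCode.succ.code))
  have hPn : Primrec Pn := primrec_compNum.comp (.const _)
    (primrec_pairNum.comp .id (primrec_compNum.comp .id (.const _)))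
  refine ⟨fun e k => compNum (rfindNum (compNum g.code
    (pairNum (compNum (Pn e) f.code) (compNum (Pn e) OracleCode.left.code)))) (constNum k),
    ?_, fun Z c a ha hc k => ?_⟩
  · have hl : Primrec fun p : ℕ × ℕ => Pn p.1 := hPn.comp .fst
    exact primrec_compNum.comp (primrec_rfindNum.comp (primrec_compNum.comp (.const _)
      (primrec_pairNum.comp (primrec_compNum.comp hl (.const _))
        (primrec_compNum.comp hl (.const _))))) (primrec_constNum.comp .snd)
  · have hP : ∀ k, (P c).eval Z k = Part.some (pos a k) := fun k =>
      (OracleCode.eval_comp (OracleCode.eval_pair (hc k)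
        ((OracleCode.eval_comp rfl).trans (hc (k + 1))))).trans
          (hd Z _ _ (ha (Nat.lt_succ_self k)).ne')
    have ht : ∀ j, (OracleCode.comp g (.pair (.comp (P c) f) (.comp (P c) .left))).eval Z
        (Nat.pair k j) = Part.some (if pos a (k + j) < pos a k then 0 else 1) := by
      intro j
      refine (OracleCode.eval_comp (OracleCode.eval_pair
        ((OracleCode.eval_comp (hf Z _)).trans (hP _))
        ((OracleCode.eval_comp rfl).trans (hP _)))).trans ((hg Z _).trans ?_)
      simp only [Nat.unpair_pair]
    refine Iff.trans (Eq.congr_left (turingJump_code Z (.comp (.rfind (.comp g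
      (.pair (.comp (P c) f) (.comp (P c) .left)))) (.const k)))) ?_
    rw [OracleCode.eval_comp (OracleCode.eval_const Z k _), OracleCode.eval_rfind_dom ht]
    simp [IsTrueStage]

variable {Z : ι → ℕ → ℕ} {c : ι → OracleCode} {a : ι → ℕ → EpsOrder α}

/-- The jump is used twice: to run the program for the sequence, and to decide true stages, which
makes the search for the next one effective. -/
theorem uniformlyComputable_derived (ha : ∀ i, StrictAnti (a i))
    (hF : ∀ i n, (c i).eval (Z i) n = Part.some (numbering ν (a i n)))
    (hJ : UniformlyComputable₂ O x fun i n => turingJump (Z i) n)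
    (hc : UniformlyComputable O x fun i => (c i).code) :
    UniformlyComputable₂ O x fun i n => numbering ν (derived (a i) n) := by
  obtain ⟨q, hq, hq'⟩ := exists_isTrueStage_query ν
  have hcomp := UniformlyComputable.eval hF hJ hc
  have hquery : UniformlyComputable₂ O x fun i k => turingJump (Z i) (q (c i).code k) :=
    UniformlyComputable.apply₂ hJ
      (UniformlyComputable.primrec₂ hq (UniformlyComputable.weaken hc) UniformlyComputable.arg)
  have hnext : UniformlyComputable₂ O x fun i k => nextTrueStage (a i) k := by
    have hp : Primrec₂ fun k m : ℕ => if k < m then 0 else 1 :=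
      Primrec.ite (Primrec.nat_lt.comp .fst .snd) (.const 0) (.const 1)
    -- A sum vanishes only if both tests succeed; the jump answers 0 at a true stage.
    have h1 : UniformlyComputable₂ (fun p : ι × ℕ => O p.1) (fun p => Nat.pair (x p.1) p.2)
        fun p m => (if p.2 < m then 0 else 1) + turingJump (Z p.1) (q (c p.1).code m) :=
      UniformlyComputable.primrec₂ Primrec.nat_add
        (UniformlyComputable.primrec₂ hp
          (UniformlyComputable.weaken (UniformlyComputable.arg (O := O) (x := x)))
          (UniformlyComputable.arg (O := fun p : ι × ℕ => O p.1)
            (x := fun p => Nat.pair (x p.1) p.2)))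
        (UniformlyComputable.weaken₂ hquery)
    have h0 : ∀ (i : ι) (k m : ℕ), (if k < m then 0 else 1) +
        turingJump (Z i) (q (c i).code m) = 0 ↔ k < m ∧ IsTrueStage (a i) m := by
      intro i k m
      rw [Nat.add_eq_zero_iff, hq' _ _ _ (ha i) (hF i)]
      simp
    refine (UniformlyComputable.sInf h1 fun p => ?_).congr fun p => ?_
    · simp only [h0]
      exact exists_isTrueStage _ _
    · simp only [h0]
      rfl
  have hstage : UniformlyComputable₂ O x fun i n => trueStage (a i) n :=
    UniformlyComputable.apply₂ (G := fun _ n => n + 1)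
      (UniformlyComputable.rec (b := fun _ => 0) (.const 0) hnext)
      (UniformlyComputable.arg.primrec Primrec.succ)
  have hval : UniformlyComputable₂ O x fun i n => numbering ν (a i (trueStage (a i) n)) :=
    UniformlyComputable.apply₂ hcomp hstage
  have hval' : UniformlyComputable₂ O x fun i n => numbering ν (a i (trueStage (a i) n + 1)) :=
    UniformlyComputable.apply₂ (G := fun i n => trueStage (a i) n + 1) hcomp
      (UniformlyComputable.primrec Primrec.succ hstage)
  exact uniformlyComputable_exponent (UniformlyComputable.apply
    (uniformlyComputable_iterate_tail hval)
    (uniformlyComputable_diffPos hval hval' fun p => (ha p.1 (Nat.lt_succ_self _)).ne'))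

/-- A single program computes derived sequences from the Turing jump. -/
theorem exists_code_derived (ν : α ↪ ℕ) : ∃ h : OracleCode,
    ∀ (Z : ℕ → ℕ) (c : OracleCode) (a : ℕ → EpsOrder α), StrictAnti a →
      (∀ n, c.eval Z n = Part.some (numbering ν (a n))) → ∀ n,
        h.eval (turingJump Z) (Nat.pair c.code n) = Part.some (numbering ν (derived a n)) := by
  obtain ⟨h, hh⟩ := uniformlyComputable_derived (ν := ν)
    (ι := {p : (ℕ → ℕ) × OracleCode × (ℕ → EpsOrder α) // StrictAnti p.2.2 ∧
      ∀ n, p.2.1.eval p.1 n = Part.some (numbering ν (p.2.2 n))})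
    (O := fun p => turingJump p.1.1) (x := fun p => p.1.2.1.code) (Z := fun p => p.1.1)
    (c := fun p => p.1.2.1) (a := fun p => p.1.2.2) (fun p => p.2.1) (fun p => p.2.2)
    UniformlyComputable.oracle UniformlyComputable.input
  exact ⟨h, fun Z c a ha hc n => hh (⟨(Z, c, a), ha, hc⟩, n)⟩

end Computability

/-- The `ω`-jump computes the first members of the iterated derived sequences. -/
theorem uniformlyComputable_iterate_derived {ν : α ↪ ℕ} {Z : ℕ → ℕ} {a : ℕ → EpsOrder α}
    (ha : StrictAnti a) (hZ : ComputableFrom Z fun n => numbering ν (a n)) :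
    UniformlyComputable (fun _ : ℕ => omegaJump Z) id
      fun n => numbering ν (derived^[n] a 0) := by
  obtain ⟨h, hh⟩ := exists_code_derived ν
  obtain ⟨c, hc⟩ := computableFrom_iff_exists_code.1 hZ
  -- The Gödel number of the old program is hard-wired into the new one, so the programs for all
  -- iterates have primitive recursively computable Gödel numbers.
  let step (c : OracleCode) : OracleCode := .comp h (.pair (.const c.code) .ident)
  have hstep : ∀ n k, (step^[n] c).eval (turingJump^[n] Z) k =
      Part.some (numbering ν (derived^[n] a k)) := by
    intro n
    induction n with
    | zero => exact hc
    | succ n ih =>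
      intro k
      simp only [Function.iterate_succ_apply']
      exact (OracleCode.eval_comp (OracleCode.eval_pair (OracleCode.eval_const _ _ k)
        (OracleCode.eval_ident _ k))).trans
          (hh _ _ _ (iterate_derived_strictAnti ha n) ih k)
  have hcode : ∀ n, (step^[n] c).code =
      (fun e => compNum h.code (pairNum (constNum e) OracleCode.ident.code))^[n] c.code := fun n =>
    Function.Semiconj.iterate_right (f := OracleCode.code) (fun _ => rfl) n c
  -- Running the n-th program, whose oracle is the n-th jump, takes the jump of that oracle: column
  -- n + 1 of the `ω`-jump.
  have hJ : UniformlyComputable₂ (fun _ : ℕ => omegaJump Z) id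
      fun n k => turingJump (turingJump^[n] Z) k := by
    have harg : UniformlyComputable₂ (fun _ : ℕ => omegaJump Z) id fun _ n => n :=
      UniformlyComputable.arg
    have h1 : UniformlyComputable₂ (fun _ : ℕ => omegaJump Z) id fun n _ => n + 1 :=
      UniformlyComputable.weaken (UniformlyComputable.input.primrec Primrec.succ)
    have h2 : UniformlyComputable₂ (fun _ : ℕ => omegaJump Z) id fun n k => Nat.pair (n + 1) k :=
      UniformlyComputable.pair h1 harg
    refine UniformlyComputable.congr
      (UniformlyComputable.apply₂ UniformlyComputable.oracle h2) fun p => ?_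
    simp [omegaJump, Function.iterate_succ_apply']
  have hc' : UniformlyComputable (fun _ : ℕ => omegaJump Z) id fun n => (step^[n] c).code := by
    simp only [hcode]
    have hs : Primrec fun e => compNum h.code (pairNum (constNum e) OracleCode.ident.code) :=
      primrec_compNum.comp (.const _) (primrec_pairNum.comp primrec_constNum (.const _))
    exact UniformlyComputable.primrec
      (Primrec.nat_iterate .id (.const c.code) (hs.comp Primrec.snd).to₂) .input
  exact UniformlyComputable.apply (UniformlyComputable.eval hstep hJ hc') (.const 0)

end EpsOrder

/-! ### Thinning out and conclusion -/

/-- An antitone sequence that is not eventually constant has a computable descending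
subsequence. -/
theorem ComputesDescendingSequence.of_antitone {α : Type*} [LinearOrder α] {ν : α ↪ ℕ} {W : ℕ → ℕ}
    {x : ℕ → α} (hx : Antitone x) (hlt : ∀ n, ∃ m, x m < x n)
    (hW : UniformlyComputable (fun _ : ℕ => W) id fun n => ν (x n)) :
    ComputesDescendingSequence W ν := by
  -- Since `x` is antitone, a changed value is a smaller one, so testing Gödel numbers for equality
  -- is enough.
  let next (n : ℕ) : ℕ := sInf {j | x (n + j) ≠ x n}
  have hex : ∀ n, ∃ j, x (n + j) ≠ x n := by
    intro n
    obtain ⟨m, hm⟩ := hlt n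
    exact ⟨m, ((hx (Nat.le_add_left m n)).trans_lt hm).ne⟩
  have harg : UniformlyComputable₂ (fun _ : ℕ => W) id fun _ n => n := UniformlyComputable.arg
  have hnext : UniformlyComputable (fun _ : ℕ => W) id fun n => n + next n := by
    have hp : Primrec₂ fun m n : ℕ => if m = n then 1 else 0 :=
      Primrec.ite (Primrec.eq.comp .fst .snd) (.const 1) (.const 0)
    have hn : UniformlyComputable₂ (fun _ : ℕ => W) id fun n _ => n :=
      UniformlyComputable.weaken .input
    have hadd : UniformlyComputable₂ (fun _ : ℕ => W) id fun n j => n + j :=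
      UniformlyComputable.primrec₂ Primrec.nat_add hn harg
    have h1 : UniformlyComputable₂ (fun _ : ℕ => W) id fun n j => ν (x (n + j)) :=
      UniformlyComputable.trans hadd (hW.reindex fun p : ℕ × ℕ => p.1 + p.2)
    have h2 : UniformlyComputable₂ (fun _ : ℕ => W) id
        fun n j => if ν (x (n + j)) = ν (x n) then 1 else 0 :=
      UniformlyComputable.primrec₂ hp h1 (UniformlyComputable.weaken hW)
    have h3 : UniformlyComputable (fun _ : ℕ => W) id next := by
      refine (UniformlyComputable.sInf h2 fun n => ?_).congr fun n => ?_
      · simpa using hex n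
      · simp [next]
    exact UniformlyComputable.primrec₂ Primrec.nat_add .input h3
  let k (n : ℕ) : ℕ := (fun n => n + next n)^[n] 0
  have hrec : UniformlyComputable₂ (fun _ : ℕ => W) id
      fun _ n => (fun n => n + next n)^[n] 0 :=
    UniformlyComputable.rec (b := fun _ => 0) (s := fun _ n => n + next n) (.const 0)
      (UniformlyComputable.trans harg (hnext.reindex Prod.snd))
  have hk : UniformlyComputable (fun _ : ℕ => W) id k :=
    UniformlyComputable.apply (g := id) hrec .input
  obtain ⟨d, hd⟩ := hk.trans (hW.reindex k)
  refine ⟨fun n => x (k n), strictAnti_nat_of_succ_lt fun n => ?_,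
    computableFrom_iff_exists_code.2 ⟨d, hd⟩⟩
  simp only [k, Function.iterate_succ_apply']
  exact lt_of_le_of_ne (hx (Nat.le_add_right _ _))
    (Nat.sInf_mem (s := {j | x (_ + j) ≠ x _}) (hex _))

theorem mainTheorem8 {α : Type*} [LinearOrder α] (ν : α ↪ ℕ) (Z : ℕ → ℕ)
    (hX : IsComputableLinearOrder Z ν)
    (hε : ComputesDescendingSequence Z (EpsOrder.numbering ν)) :
    ComputesDescendingSequence (omegaJump Z) ν := by
  obtain ⟨a, ha, hZ⟩ := hε
  let b (n : ℕ) : EpsOrder α := EpsOrder.derived^[n] a 0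
  have hb : UniformlyComputable (fun _ : ℕ => omegaJump Z) id fun n => EpsOrder.numbering ν (b n) :=
    EpsOrder.uniformlyComputable_iterate_derived ha hZ
  -- This vanishes exactly when the m-th leading exponent is a constant, so `k n` is found by
  -- search.
  let f (n m : ℕ) : ℕ := (EpsOrder.numbering ν (EpsOrder.exponent^[m] (b n)) + 2) % 3
  let k (n : ℕ) : ℕ := sInf {m | f n m = 0}
  have hex : ∀ n, ∃ m, f n m = 0 := by
    intro n
    obtain ⟨m, x, h⟩ := EpsOrder.exists_iterate_exponent_derived ha n
    refine ⟨m, ?_⟩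
    simp only [f, b, h]
    change (3 * ν x + 1 + 2) % 3 = 0
    omega
  have hk : ∀ n, ∃ x, EpsOrder.exponent^[k n] (b n) = EpsOrder.eps x := by
    intro n
    have h : f n (k n) = 0 := Nat.sInf_mem (s := {m | f n m = 0}) (hex n)
    exact EpsOrder.exists_eq_eps_of_numbering h
  choose x hx using hk
  have hf : UniformlyComputable₂ (fun _ : ℕ => omegaJump Z) id f :=
    (UniformlyComputable.primrec (f := fun m => (m + 2) % 3) (Primrec.nat_mod.comp
      (Primrec.nat_add.comp .id (.const 2)) (.const 3))
      (EpsOrder.uniformlyComputable_iterate_exponent hb))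
  have hνx : UniformlyComputable (fun _ : ℕ => omegaJump Z) id fun n => ν (x n) := by
    -- Division by 3 recovers the index from the Gödel number 3 · ν x + 1 of ε_x.
    refine (UniformlyComputable.primrec (f := fun m => m / 3)
      (Primrec.nat_div.comp .id (.const 3)) (UniformlyComputable.apply
        (EpsOrder.uniformlyComputable_iterate_exponent hb) (UniformlyComputable.sInf hf hex))).congr
        fun n => ?_
    change EpsOrder.numbering ν (EpsOrder.exponent^[k n] (b n)) / 3 = _
    rw [hx]
    change (3 * ν (x n) + 1) / 3 = ν (x n)
    omega
  exact .of_antitone (EpsOrder.leading_antitone ha hx) (EpsOrder.exists_leading_lt ha hx) hνx
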